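/- For a finite simple graph $G$, the Estrada index is $EE(G)=\sum_i e^{\lambda_i}$, the sum over the eigenvalues of the adjacency matrix of $G$, counted with multiplicity. The connectivity $\kappa(G)$ is the minimum of $|V(G)|-1$ and of the numbers $|S|$, where $S\subseteq V(G)$ is a vertex cut (that is, $G-S$ has at least two components). For integers $n$ and $s\ge 1$ let $\mathcal C_{n,s}$ be the class of bipartite graphs $G$ on $n$ vertices with $\kappa(G)=s$. For $p,q\ge 0$ let $O_s\vee_1(K_1\cup K_{p,q})$ be the graph obtained from the disjoint union of an empty graph $O_s$ on $s$ vertices, a single vertex $K_1$ and a complete bipartite graph $K_{p,q}$ by joining every vertex of $O_s$ to the vertex of $K_1$ and to all vertices of the part of size $p$ of $K_{p,q}$. **Theorem.** Let $s\ge 1$. 1. If $n>2s$, then $$O_s\vee_1\bigl(K_1\cup K_{\lceil (n-1)/2\rceil,\ \lfloor (n-1)/2\rfloor-s}\bigr)$$ belongs to $\mathcal C_{n,s}$ and is, up to isomorphism, the unique graph of maximum Estrada index in $\mathcal C_{n,s}$. 2. If $n=2s$, then $K_{s,s}\cong O_s\vee_1(K_1\cup K_{s-1,0})$ belongs to $\mathcal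 C_{n,s}$ and is, up to isomorphism, the unique graph of maximum Estrada index in $\mathcal C_{n,s}$. -/

import Mathlib

universe u v

namespace EstradaBip

/-- The Estrada index: the sum of `exp lam` over the eigenvalues `lam` of the adjacency matrix,
counted with multiplicity. -/
noncomputable def estradaIndex {V : Type u} [Fintype V] (G : SimpleGraph V) : ℝ :=
  open Classical in
  ∑ i, Real.exp ((G.isHermitian_adjMatrix ℝ).eigenvalues i)

/-- `S` is a vertex cut of `G`: the graph left after removing `S` has at least two components. -/
def IsVertexCut {V : Type u} (G : SimpleGraph V) (S : Finset V) : Prop :=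
  ¬ (G.induce {x | x ∉ S}).Preconnected

/-- The (vertex-)connectivity of a finite graph: the minimum of `|V| - 1` and of the sizes of the
vertex cuts of `G`. -/
noncomputable def vertexConnectivity {V : Type u} [Fintype V] (G : SimpleGraph V) : ℕ :=
  sInf {k | k = Fintype.card V - 1 ∨ ∃ S : Finset V, IsVertexCut G S ∧ S.card = k}

/-- Membership in the class of bipartite graphs with `n` vertices and connectivity `s`. -/
def InClass (n s : ℕ) {V : Type u} [Fintype V] (G : SimpleGraph V) : Prop :=
  Fintype.card V = n ∧ G.IsBipartite ∧ vertexConnectivity G = s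

/-- The vertex set of `joinOne s n₁ n₂ m₁ m₂`. -/
abbrev JoinOneVertex (s n₁ n₂ m₁ m₂ : ℕ) : Type :=
  Fin s ⊕ ((Fin n₁ ⊕ Fin n₂) ⊕ (Fin m₁ ⊕ Fin m₂))

/-- The vertex lies in the part of size `n₁` of `K_{n₁,n₂}` or in the part of size `m₁` of
`K_{m₁,m₂}`. -/
inductive InFirstPart {n₁ n₂ m₁ m₂ : ℕ} : (Fin n₁ ⊕ Fin n₂) ⊕ (Fin m₁ ⊕ Fin m₂) → Prop
  | left (i : Fin n₁) : InFirstPart (.inl (.inl i))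
  | right (i : Fin m₁) : InFirstPart (.inr (.inl i))

/-- The graph `O_s ∨₁ (K_{n₁,n₂} ∪ K_{m₁,m₂})`: the disjoint union of an empty graph on `s`
vertices and two complete bipartite graphs, together with all edges between the `s` vertices and
the parts of sizes `n₁` and `m₁`. -/
def joinOne (s n₁ n₂ m₁ m₂ : ℕ) : SimpleGraph (JoinOneVertex s n₁ n₂ m₁ m₂) :=
  SimpleGraph.sum (⊥ : SimpleGraph (Fin s))
      (SimpleGraph.sum (completeBipartiteGraph (Fin n₁) (Fin n₂))
        (completeBipartiteGraph (Fin m₁) (Fin m₂))) ⊔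
    SimpleGraph.fromRel (fun x y => ∃ a w, x = Sum.inl a ∧ y = Sum.inr w ∧ InFirstPart w)

/-- The graph `O_s ∨₁ (K_1 ∪ K_{p,q})`, where `K_1 = K_{1,0}`. -/
abbrev joinOneK1 (s p q : ℕ) : SimpleGraph (JoinOneVertex s 1 0 p q) :=
  joinOne s 1 0 p q

/-- `H` is, up to isomorphism, the unique graph of maximum Estrada index among the bipartite graphs
with `n` vertices and connectivity `s`. -/
def IsUniqueMaximizer (n s : ℕ) {W : Type v} [Fintype W] (H : SimpleGraph W) : Prop :=
  InClass n s H ∧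
    ∀ (V : Type u) [Fintype V] (G : SimpleGraph V), InClass n s G →
      estradaIndex G ≤ estradaIndex H ∧
        (estradaIndex G = estradaIndex H → Nonempty (G ≃g H))

end EstradaBip

/-!
For a bipartite graph the spectrum is symmetric about `0`, so the Estrada index is
`n + 2 ∑ (cosh λ - 1)` over the positive eigenvalues `λ`, and the squares `λ ^ 2` of these sum to the
number of edges. As `cosh ∘ √` is increasing and convex, a weak majorization argument
(`sum_cosh_sqrt_sub_one_le`) bounds the Estrada index in terms of a bound `X` on the squared spectral
radius and a bound `X + y` on the number of edges, the extreme case being the two squares `X, y`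
(`estradaIndex_le`, `estradaIndex_lt`).

The graph `H = O_s ∨₁ (K_1 ∪ K_{p,b-s})` has biadjacency matrix of rank at most two, so the squares
of its positive eigenvalues are `X > y`, or `X` alone if `y = 0`, with `X + y = p * b + s` its number
of edges
(`le_estradaIndex_joinOneK1`). Hence the claim for `n > 2 * s` follows once `H`, with `p` and `b` the
halves of `n - 1`, is shown to maximize both the number of edges and the spectral radius in the class,
with care about equality.

Every degree in a graph of connectivity `s` is at least `s`. If some vertex `v` has degree exactly
`s`, the graph is a spanning subgraph of some `O_s ∨₁ (K_1 ∪ K_{c,e-s})` with `c + e = p + b`. The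
eigenvector of that graph serves as a test vector for a Collatz–Wielandt bound
(`adjEigenvalues_sq_le_of_mem`), and the condition that it satisfies this with bound `X` factors as
`(c - p) * ((c - b) * (X - s) - s ^ 2) ≥ 0`, with equality only for `c = p`
(`quadratic_pos_of_ne`). If all degrees exceed `s`, the two parts separated by a minimum vertex cut meet
both sides of the bipartition, and so many edges are missing between them that at most `p * b < X`
remain (`four_mul_card_edgeFinset_le`); this also bounds the squared spectral radius.

For `n = 2 * s` the bound on the minimum degree alone forces the graph to be `K_{s,s}`.
-/

namespace EstradaBip

open Finset

/-! ### Convexity of `cosh ∘ √` -/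

theorem hasSum_cosh_sqrt {x : ℝ} (hx : 0 ≤ x) :
    HasSum (fun k => x ^ k / ((2 * k).factorial : ℝ)) (Real.cosh √x) := by
  have h := Real.hasSum_cosh √x
  simpa [pow_mul, Real.sq_sqrt hx] using h

theorem cosh_sqrt_strictMono {x y : ℝ} (hx : 0 ≤ x) (hxy : x < y) :
    Real.cosh √x < Real.cosh √y := by
  rw [Real.cosh_lt_cosh, abs_of_nonneg (Real.sqrt_nonneg _), abs_of_nonneg (Real.sqrt_nonneg _)]
  exact Real.sqrt_lt_sqrt hx hxy

theorem cosh_sqrt_mono {x y : ℝ} (hxy : x ≤ y) : Real.cosh √x ≤ Real.cosh √y := by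
  rw [Real.cosh_le_cosh, abs_of_nonneg (Real.sqrt_nonneg _), abs_of_nonneg (Real.sqrt_nonneg _)]
  exact Real.sqrt_le_sqrt hxy

theorem pow_add_pow_le_of_spread {a b c : ℝ} (k : ℕ) (ha : 0 ≤ a) (hb : 0 ≤ b) (hac : a ≤ c)
    (hbc : b ≤ c) (hcab : c ≤ a + b) : a ^ k + b ^ k ≤ c ^ k + (a + b - c) ^ k := by
  induction k with
  | zero => simp
  | succ k ih =>
    have h1 : a ^ k ≤ c ^ k := pow_le_pow_left₀ ha hac k
    have h2 : (a + b - c) ^ k ≤ b ^ k := pow_le_pow_left₀ (by linarith) (by linarith) k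
    have h3 : b ^ k ≤ c ^ k := pow_le_pow_left₀ hb hbc k
    simp only [pow_succ]
    nlinarith [mul_nonneg hb (sub_nonneg.2 ih), mul_nonneg (sub_nonneg.2 hac) (sub_nonneg.2 h1),
      mul_nonneg (sub_nonneg.2 hac) (sub_nonneg.2 h2), mul_nonneg (sub_nonneg.2 hac) (sub_nonneg.2 h3),
      mul_nonneg ha (sub_nonneg.2 ih)]

/-- Moving two numbers apart while keeping their sum increases the sum of the values of the
convex function `cosh ∘ √`. -/
theorem cosh_sqrt_add_le_of_spread {a b c : ℝ} (ha : 0 ≤ a) (hb : 0 ≤ b) (hac : a ≤ c)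
    (hbc : b ≤ c) (hcab : c ≤ a + b) :
    Real.cosh √a + Real.cosh √b ≤ Real.cosh √c + Real.cosh √(a + b - c) := by
  refine hasSum_le (fun k => ?_) ((hasSum_cosh_sqrt ha).add (hasSum_cosh_sqrt hb))
    ((hasSum_cosh_sqrt (ha.trans hac)).add (hasSum_cosh_sqrt (sub_nonneg.2 hcab)))
  rw [← add_div, ← add_div]
  exact div_le_div_of_nonneg_right (pow_add_pow_le_of_spread k ha hb hac hbc hcab)
    (Nat.cast_nonneg _)

theorem cosh_sqrt_add_lt_of_spread {a b c : ℝ} (ha : 0 ≤ a) (hb : 0 ≤ b) (hac : a < c)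
    (hbc : b < c) (hcab : c ≤ a + b) :
    Real.cosh √a + Real.cosh √b < Real.cosh √c + Real.cosh √(a + b - c) := by
  refine hasSum_lt (i := 2) (fun k => ?_) ?_ ((hasSum_cosh_sqrt ha).add (hasSum_cosh_sqrt hb))
    ((hasSum_cosh_sqrt (ha.trans hac.le)).add (hasSum_cosh_sqrt (sub_nonneg.2 hcab)))
  · simp only []
    rw [← add_div, ← add_div]
    exact div_le_div_of_nonneg_right (pow_add_pow_le_of_spread k ha hb hac.le hbc.le hcab)
      (Nat.cast_nonneg _)
  · rw [← add_div, ← add_div]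
    refine div_lt_div_of_pos_right ?_ (by positivity)
    nlinarith [mul_pos (sub_pos.2 hac) (sub_pos.2 hbc)]

theorem cosh_sqrt_superadditive {a b : ℝ} (ha : 0 ≤ a) (hb : 0 ≤ b) :
    Real.cosh √a + Real.cosh √b ≤ Real.cosh √(a + b) + 1 := by
  simpa using cosh_sqrt_add_le_of_spread ha hb (c := a + b) (by linarith) (by linarith) le_rfl

/-- For a family in `[0, X]` of sum `σ ≤ 2 * X`, the sum of the values of `cosh ∘ √ - 1` is at most
that for the most spread family of the same sum: `σ, 0, …` if `σ ≤ X` and `X, σ - X, 0, …`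
otherwise. -/
theorem sum_cosh_sqrt_sub_one_le_aux {ι : Type*} (I : Finset ι) (x : ι → ℝ) {X : ℝ} (hX : 0 ≤ X)
    (hx0 : ∀ i ∈ I, 0 ≤ x i) (hxX : ∀ i ∈ I, x i ≤ X) (hsum : ∑ i ∈ I, x i ≤ 2 * X) :
    ∑ i ∈ I, (Real.cosh √(x i) - 1) ≤
      (Real.cosh √(min X (∑ i ∈ I, x i)) - 1) + (Real.cosh √(max 0 (∑ i ∈ I, x i - X)) - 1) := by
  classical
  induction I using Finset.induction_on with
  | empty => simp [hX]
  | insert j I hj ih =>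
    rw [Finset.sum_insert hj] at hsum
    rw [Finset.sum_insert hj, Finset.sum_insert hj]
    have hj0 := hx0 j (Finset.mem_insert_self _ _)
    have hjX := hxX j (Finset.mem_insert_self _ _)
    have ih' := ih (fun i hi => hx0 i (Finset.mem_insert_of_mem hi))
      (fun i hi => hxX i (Finset.mem_insert_of_mem hi)) (by linarith)
    have hσ : 0 ≤ ∑ i ∈ I, x i :=
      Finset.sum_nonneg fun i hi => hx0 i (Finset.mem_insert_of_mem hi)
    set σ := ∑ i ∈ I, x i
    rcases le_total X σ with h | h
    · rw [min_eq_left h, max_eq_right (by linarith)] at ih'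
      rw [min_eq_left (by linarith), max_eq_right (by linarith)]
      have := cosh_sqrt_superadditive hj0 (sub_nonneg.2 h)
      rw [← add_sub_assoc] at this
      linarith
    · rw [min_eq_right h, max_eq_left (by linarith)] at ih'
      rcases le_total X (x j + σ) with h' | h'
      · rw [min_eq_left h', max_eq_right (by linarith)]
        have := cosh_sqrt_add_le_of_spread hj0 hσ hjX h h'
        rw [Real.sqrt_zero, Real.cosh_zero] at ih'
        linarith
      · rw [min_eq_right h', max_eq_left (by linarith)]
        have := cosh_sqrt_superadditive hj0 hσ
        rw [Real.sqrt_zero, Real.cosh_zero] at ih' ⊢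
        linarith

/-- A weak majorization inequality: among families in `[0, X]` of sum at most `X + y`, where
`0 ≤ y ≤ X`, the sum of the values of `cosh ∘ √ - 1` is largest for the family `X, y, 0, …`. -/
theorem sum_cosh_sqrt_sub_one_le {ι : Type*} (I : Finset ι) (x : ι → ℝ) {X y : ℝ} (hy : 0 ≤ y)
    (hyX : y ≤ X) (hx0 : ∀ i ∈ I, 0 ≤ x i) (hxX : ∀ i ∈ I, x i ≤ X)
    (hsum : ∑ i ∈ I, x i ≤ X + y) :
    ∑ i ∈ I, (Real.cosh √(x i) - 1) ≤ (Real.cosh √X - 1) + (Real.cosh √y - 1) := by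
  refine (sum_cosh_sqrt_sub_one_le_aux I x (hy.trans hyX) hx0 hxX (by linarith)).trans ?_
  gcongr ?_ - 1 + (?_ - 1)
  · exact cosh_sqrt_mono (min_le_left _ _)
  · exact cosh_sqrt_mono (max_le hy (by linarith))

theorem sum_cosh_sqrt_sub_one_lt {ι : Type*} (I : Finset ι) (x : ι → ℝ) {X y : ℝ} (hy : 0 ≤ y)
    (hyX : y ≤ X) (hx0 : ∀ i ∈ I, 0 ≤ x i) (hxX : ∀ i ∈ I, x i ≤ X)
    (hsum : ∑ i ∈ I, x i < X + y) :
    ∑ i ∈ I, (Real.cosh √(x i) - 1) < (Real.cosh √X - 1) + (Real.cosh √y - 1) := by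
  refine (sum_cosh_sqrt_sub_one_le_aux I x (hy.trans hyX) hx0 hxX (by linarith)).trans_lt ?_
  have h0 : 0 ≤ ∑ i ∈ I, x i := Finset.sum_nonneg hx0
  rcases lt_or_ge (∑ i ∈ I, x i) X with h | h
  · rw [min_eq_right h.le, max_eq_left (by linarith)]
    have := cosh_sqrt_strictMono h0 h
    have := cosh_sqrt_mono hy
    linarith
  · rw [min_eq_left h, max_eq_right (by linarith)]
    have := cosh_sqrt_strictMono (sub_nonneg.2 h) (y := y) (by linarith)
    linarith

/-! ### Spectra of symmetric matrices -/

section Spectral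

variable {V : Type*} [Fintype V] [DecidableEq V] {A : Matrix V V ℝ}

theorem charpoly_neg_eq (A : Matrix V V ℝ) :
    (-A).charpoly =
      Polynomial.C ((-1) ^ Fintype.card V) * A.charpoly.comp (-Polynomial.X) := by
  refine Polynomial.funext fun r => ?_
  rw [Polynomial.eval_mul, Polynomial.eval_comp, Matrix.eval_charpoly, Matrix.eval_charpoly,
    Polynomial.eval_C, ← Matrix.det_neg]
  congr 1
  ext i j
  rcases eq_or_ne i j with rfl | hij
  · simp [add_comm]
  · simp [hij]

theorem sum_eigenvalues_eq_roots (hA : A.IsHermitian) (F : ℝ → ℝ) :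
    ∑ i, F (hA.eigenvalues i) = (A.charpoly.roots.map F).sum := by
  rw [hA.roots_charpoly_eq_eigenvalues, Multiset.map_map]
  rfl

/-- If a diagonal conjugation by signs turns `A` into `-A`, the spectrum of `A` is symmetric
about `0`, with multiplicities. -/
theorem sum_eigenvalues_neg (hA : A.IsHermitian) (σ : V → ℝ) (hσ : ∀ i, σ i * σ i = 1)
    (hAσ : ∀ i j, σ i * A i j * σ j = -A i j) (F : ℝ → ℝ) :
    ∑ i, F (-hA.eigenvalues i) = ∑ i, F (hA.eigenvalues i) := by
  have hD : Matrix.diagonal σ * Matrix.diagonal σ = 1 := by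
    rw [Matrix.diagonal_mul_diagonal, ← Matrix.diagonal_one]
    congr 1
    exact funext hσ
  have hconj : -A = Matrix.diagonal σ * A * Matrix.diagonal σ := by
    ext i j
    rw [Matrix.mul_diagonal, Matrix.diagonal_mul, hAσ, Matrix.neg_apply]
  have h1 : (-A).charpoly = A.charpoly := by
    rw [hconj, Matrix.charpoly_mul_comm, ← mul_assoc, hD, one_mul]
  have h2 : A.charpoly.roots = A.charpoly.roots.map fun x => -x := by
    conv_lhs => rw [← h1, charpoly_neg_eq, Polynomial.roots_C_mul _ (by simp),
      Polynomial.roots_comp_neg_X]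
  rw [sum_eigenvalues_eq_roots hA F, sum_eigenvalues_eq_roots hA (fun x => F (-x))]
  conv_rhs => rw [h2, Multiset.map_map]
  rfl

theorem sum_eigenvalues_sq (hA : A.IsHermitian) :
    ∑ i, hA.eigenvalues i ^ 2 = ∑ i, ∑ j, A i j ^ 2 := by
  have h1 : (A * A).trace = ∑ i, ∑ j, A i j ^ 2 := by
    simp only [Matrix.trace, Matrix.diag, Matrix.mul_apply]
    refine Finset.sum_congr rfl fun i _ => Finset.sum_congr rfl fun j _ => ?_
    have : A j i = A i j := by simpa using hA.apply i j
    rw [this, sq]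
  rw [← h1]
  conv_rhs => rw [hA.spectral_theorem, ← map_mul, Unitary.conjStarAlgAut_apply,
    Matrix.trace_mul_cycle, Matrix.diagonal_mul_diagonal]
  simp [Matrix.trace, sq]

theorem exists_eigenvalues_eq (hA : A.IsHermitian) {w : V → ℝ} (hw : w ≠ 0) {r : ℝ}
    (h : A.mulVec w = r • w) : ∃ i, hA.eigenvalues i = r := by
  have : r ∈ spectrum ℝ A := by
    rw [← Matrix.spectrum_toLin']
    refine Module.End.HasEigenvalue.mem_spectrum ?_
    exact Module.End.hasEigenvalue_of_hasEigenvector (x := w)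
      ⟨Module.End.mem_eigenspace_iff.2 (by simpa using h), hw⟩
  rwa [hA.spectrum_real_eq_range_eigenvalues] at this

/-- The Collatz–Wielandt bound: a positive vector `w` with `A w ≤ ρ w` bounds the spectrum of the
nonnegative matrix `A`. -/
theorem abs_eigenvalues_le (hA : A.IsHermitian) (hA0 : ∀ i j, 0 ≤ A i j) {w : V → ℝ}
    (hw : ∀ i, 0 < w i) {ρ : ℝ} (h : ∀ i, ∑ j, A i j * w j ≤ ρ * w i) (k : V) :
    |hA.eigenvalues k| ≤ ρ := by
  set x : V → ℝ := (hA.eigenvectorBasis k).ofLp with hx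
  have hev : ∀ i, ∑ j, A i j * x j = hA.eigenvalues k * x i := fun i => by
    simpa [Matrix.mulVec, dotProduct] using congrFun (hA.mulVec_eigenvectorBasis k) i
  have hne : x ≠ 0 := fun h0 => hA.eigenvectorBasis.toBasis.ne_zero k (by
    simpa [hx] using h0)
  -- The eigenvalue equation is estimated in a coordinate where `|x i| / w i` is largest.
  obtain ⟨m, -, hm⟩ := Finset.exists_max_image univ (fun i => |x i| / w i) ⟨k, mem_univ k⟩
  set r := |x m| / w m
  have hr : ∀ i, |x i| ≤ r * w i := fun i => (div_le_iff₀ (hw i)).1 (hm i (mem_univ i))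
  have hrm : |x m| = r * w m := by rw [div_mul_cancel₀ _ (hw m).ne']
  have hxm : 0 < |x m| := by
    obtain ⟨i, hi⟩ := Function.ne_iff.1 hne
    have : 0 < r := by
      by_contra hr0
      exact absurd ((hr i).trans (mul_nonpos_of_nonpos_of_nonneg (not_lt.1 hr0) (hw i).le))
        (not_le.2 (abs_pos.2 hi))
    rw [hrm]
    exact mul_pos this (hw m)
  have hr0 : 0 ≤ r := div_nonneg (abs_nonneg _) (hw m).le
  refine le_of_mul_le_mul_right ?_ hxm
  calc |hA.eigenvalues k| * |x m| = |∑ j, A m j * x j| := by rw [hev, abs_mul]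
    _ ≤ ∑ j, |A m j * x j| := Finset.abs_sum_le_sum_abs _ _
    _ ≤ ∑ j, r * (A m j * w j) := by
      refine Finset.sum_le_sum fun j _ => ?_
      rw [abs_mul, abs_of_nonneg (hA0 m j)]
      nlinarith [mul_le_mul_of_nonneg_left (hr j) (hA0 m j)]
    _ ≤ r * (ρ * w m) := by
      rw [← Finset.mul_sum]
      exact mul_le_mul_of_nonneg_left (h m) hr0
    _ = ρ * |x m| := by rw [hrm]; ring

end Spectral

/-! ### Bounds on the Estrada index of a bipartite graph -/

section Bounds

variable {V : Type*} [Fintype V]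

open Classical in
/-- The eigenvalues of the adjacency matrix, indexed by the vertices. -/
noncomputable def adjEigenvalues (G : SimpleGraph V) : V → ℝ :=
  (G.isHermitian_adjMatrix ℝ).eigenvalues

theorem estradaIndex_eq_sum_exp (G : SimpleGraph V) :
    estradaIndex G = ∑ i, Real.exp (adjEigenvalues G i) := rfl

theorem estradaIndex_eq_of_iso {W : Type*} [Fintype W] {G : SimpleGraph V} {H : SimpleGraph W}
    (e : G ≃g H) : estradaIndex G = estradaIndex H := by
  classical
  rw [estradaIndex, estradaIndex, sum_eigenvalues_eq_roots _ Real.exp,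
    sum_eigenvalues_eq_roots _ Real.exp, ← Matrix.charpoly_reindex e.toEquiv]
  congr 4
  ext i j
  have : G.Adj (e.symm i) (e.symm j) ↔ H.Adj i j := e.symm.map_adj_iff
  rw [Matrix.reindex_apply, Matrix.submatrix_apply, SimpleGraph.adjMatrix_apply,
    SimpleGraph.adjMatrix_apply]
  exact if_congr this rfl rfl

theorem sum_adjEigenvalues (G : SimpleGraph V) : ∑ i, adjEigenvalues G i = 0 := by
  classical
  have h := (G.isHermitian_adjMatrix ℝ).trace_eq_sum_eigenvalues
  rw [SimpleGraph.trace_adjMatrix] at h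
  exact h.symm

open Classical in
theorem sum_adjEigenvalues_sq (G : SimpleGraph V) :
    ∑ i, adjEigenvalues G i ^ 2 = 2 * (#G.edgeFinset : ℝ) := by
  have h1 : ((∑ v, G.degree v : ℕ) : ℝ) = 2 * (#G.edgeFinset : ℝ) := by
    rw [G.sum_degrees_eq_twice_card_edges]; push_cast; rfl
  rw [← h1, adjEigenvalues, sum_eigenvalues_sq, Nat.cast_sum]
  refine Finset.sum_congr rfl fun i _ => ?_
  simp only [SimpleGraph.adjMatrix_apply, ite_pow, one_pow, ne_eq, OfNat.ofNat_ne_zero,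
    not_false_eq_true, zero_pow, Finset.sum_boole]
  congr 2
  ext j
  simp

theorem sum_adjEigenvalues_neg {G : SimpleGraph V} (hG : G.IsBipartite) (F : ℝ → ℝ) :
    ∑ i, F (-adjEigenvalues G i) = ∑ i, F (adjEigenvalues G i) := by
  classical
  obtain ⟨c⟩ := hG
  refine sum_eigenvalues_neg _ (fun i => if c i = 0 then 1 else -1) (fun i => ?_)
    (fun i j => ?_) F
  · split_ifs <;> norm_num
  · rw [SimpleGraph.adjMatrix_apply]
    by_cases h : G.Adj i j
    · have := c.valid h
      rcases Fin.exists_fin_two.1 ⟨c i, rfl⟩ with hi | hi <;>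
      rcases Fin.exists_fin_two.1 ⟨c j, rfl⟩ with hj | hj <;>
      simp_all
    · simp [h]

/-- For a function vanishing at `0`, a sum over a symmetric spectrum is twice the sum over its
positive part. -/
theorem sum_adjEigenvalues_even {G : SimpleGraph V} (hG : G.IsBipartite) {F : ℝ → ℝ}
    (hF0 : F 0 = 0) (hF : ∀ x, F (-x) = F x) :
    ∑ i, F (adjEigenvalues G i) =
      2 * ∑ i with 0 < adjEigenvalues G i, F (adjEigenvalues G i) := by
  have h := sum_adjEigenvalues_neg hG fun x => if 0 < x then F x else 0
  rw [Finset.sum_filter, two_mul]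
  nth_rw 1 [← h]
  rw [← Finset.sum_add_distrib]
  refine Finset.sum_congr rfl fun i _ => ?_
  rcases lt_trichotomy (adjEigenvalues G i) 0 with hi | hi | hi
  · simp [hi, hi.le, hF]
  · simp [hi, hF0]
  · simp [hi, hi.le]

open Classical in
theorem sum_pos_adjEigenvalues_sq {G : SimpleGraph V} (hG : G.IsBipartite) :
    ∑ i with 0 < adjEigenvalues G i, adjEigenvalues G i ^ 2 = (#G.edgeFinset : ℝ) := by
  have h := sum_adjEigenvalues_even hG (F := fun x => x ^ 2) (by simp) (by simp)
  have := sum_adjEigenvalues_sq G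
  linarith

theorem estradaIndex_eq_of_isBipartite {G : SimpleGraph V} (hG : G.IsBipartite) :
    estradaIndex G = Fintype.card V + 2 * ∑ i with 0 < adjEigenvalues G i,
      (Real.cosh √(adjEigenvalues G i ^ 2) - 1) := by
  have h := sum_adjEigenvalues_even hG (F := fun x => Real.cosh √(x ^ 2) - 1) (by simp) (by simp)
  have hexp := sum_adjEigenvalues_neg hG Real.exp
  rw [← h, Finset.sum_sub_distrib, estradaIndex_eq_sum_exp]
  have : ∑ i, Real.cosh √(adjEigenvalues G i ^ 2) = ∑ i, Real.exp (adjEigenvalues G i) := by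
    simp only [Real.sqrt_sq_eq_abs, Real.cosh_abs]
    simp only [Real.cosh_eq]
    rw [← Finset.sum_div, Finset.sum_add_distrib, hexp]
    ring
  rw [this]
  simp

open Classical in
/-- The positive eigenvalues of a bipartite graph with `m` edges have squares summing to `m`, so a
bound `X` on those squares and a bound `X + y` on `m` bound the Estrada index. -/
theorem estradaIndex_le {G : SimpleGraph V} (hG : G.IsBipartite) {X y : ℝ} (hy : 0 ≤ y)
    (hyX : y ≤ X) (hX : ∀ i, adjEigenvalues G i ^ 2 ≤ X) (hm : (#G.edgeFinset : ℝ) ≤ X + y) :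
    estradaIndex G ≤ Fintype.card V + 2 * ((Real.cosh √X - 1) + (Real.cosh √y - 1)) := by
  rw [estradaIndex_eq_of_isBipartite hG]
  have := sum_cosh_sqrt_sub_one_le {i | 0 < adjEigenvalues G i} (fun i => adjEigenvalues G i ^ 2)
    hy hyX (fun i _ => sq_nonneg _) (fun i _ => hX i) (by rwa [sum_pos_adjEigenvalues_sq hG])
  linarith

open Classical in
theorem estradaIndex_lt {G : SimpleGraph V} (hG : G.IsBipartite) {X y : ℝ} (hy : 0 ≤ y)
    (hyX : y ≤ X) (hX : ∀ i, adjEigenvalues G i ^ 2 ≤ X) (hm : (#G.edgeFinset : ℝ) < X + y) :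
    estradaIndex G < Fintype.card V + 2 * ((Real.cosh √X - 1) + (Real.cosh √y - 1)) := by
  rw [estradaIndex_eq_of_isBipartite hG]
  have := sum_cosh_sqrt_sub_one_lt {i | 0 < adjEigenvalues G i} (fun i => adjEigenvalues G i ^ 2)
    hy hyX (fun i _ => sq_nonneg _) (fun i _ => hX i) (by rwa [sum_pos_adjEigenvalues_sq hG])
  linarith

open Classical in
theorem adjEigenvalues_sq_le_card_edgeFinset {G : SimpleGraph V} (hG : G.IsBipartite) (i : V) :
    adjEigenvalues G i ^ 2 ≤ #G.edgeFinset := by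
  have key : ∀ j, 0 < adjEigenvalues G j → adjEigenvalues G j ^ 2 ≤ #G.edgeFinset := fun j hj => by
    rw [← sum_pos_adjEigenvalues_sq hG]
    exact Finset.single_le_sum (f := fun i => adjEigenvalues G i ^ 2) (fun i _ => sq_nonneg _)
      (by simpa using hj)
  rcases lt_trichotomy (adjEigenvalues G i) 0 with hi | hi | hi
  -- The opposite of a negative eigenvalue is an eigenvalue too: count its occurrences.
  · have h := sum_adjEigenvalues_neg hG fun x => if x = -adjEigenvalues G i then 1 else 0
    have h1 : (1 : ℝ) ≤ ∑ j, if -adjEigenvalues G j = -adjEigenvalues G i then 1 else 0 :=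
      (by simp : (1 : ℝ) ≤ if -adjEigenvalues G i = -adjEigenvalues G i then 1 else 0).trans
        (Finset.single_le_sum (f := fun j => if -adjEigenvalues G j = -adjEigenvalues G i
          then (1 : ℝ) else 0) (fun j _ => by split_ifs <;> norm_num) (mem_univ i))
    rw [h] at h1
    obtain ⟨j, hj⟩ : ∃ j, adjEigenvalues G j = -adjEigenvalues G i := by
      by_contra hne
      push Not at hne
      simp only [hne, if_false, Finset.sum_const_zero] at h1
      linarith
    have := key j (by linarith)
    rwa [hj, neg_sq] at this
  · simp [hi]
  · exact key i hi

/-- The summands `exp μ - 1 - μ` are nonnegative and the eigenvalues sum to `0`, so any set of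
eigenvalues bounds the Estrada index from below. -/
theorem le_estradaIndex_of_subset (G : SimpleGraph V) (R : Finset ℝ)
    (hR : ∀ μ ∈ R, ∃ i, adjEigenvalues G i = μ) :
    Fintype.card V + ∑ μ ∈ R, (Real.exp μ - 1 - μ) ≤ estradaIndex G := by
  have h0 : ∀ μ : ℝ, 0 ≤ Real.exp μ - 1 - μ := fun μ => by linarith [Real.add_one_le_exp μ]
  have h1 : ∑ μ ∈ R, (Real.exp μ - 1 - μ) ≤
      ∑ i, (Real.exp (adjEigenvalues G i) - 1 - adjEigenvalues G i) :=
    (Finset.sum_le_sum_of_subset_of_nonneg (fun μ hμ => by simpa using hR μ hμ)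
      (fun μ _ _ => h0 μ)).trans
        (Finset.sum_image_le_of_nonneg (s := univ) (g := adjEigenvalues G) fun μ _ => h0 μ)
  have h2 : ∑ i, (Real.exp (adjEigenvalues G i) - 1 - adjEigenvalues G i) =
      estradaIndex G - Fintype.card V := by
    rw [Finset.sum_sub_distrib, Finset.sum_sub_distrib, sum_adjEigenvalues,
      ← estradaIndex_eq_sum_exp]
    simp
  linarith

theorem exists_adjEigenvalues_eq (G : SimpleGraph V) {w : V → ℝ} (hw : w ≠ 0) {r : ℝ}
    (h : open Classical in ∀ x, ∑ z ∈ G.neighborFinset x, w z = r * w x) :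
    ∃ i, adjEigenvalues G i = r := by
  classical
  refine exists_eigenvalues_eq _ hw ?_
  ext x
  rw [SimpleGraph.adjMatrix_mulVec_apply]
  simpa using h x

theorem adjEigenvalues_sq_le (G : SimpleGraph V) {w : V → ℝ} (hw : ∀ x, 0 < w x) {z : ℝ}
    (hz : 0 ≤ z) (h : open Classical in ∀ x, ∑ y ∈ G.neighborFinset x, w y ≤ √z * w x) (i : V) :
    adjEigenvalues G i ^ 2 ≤ z := by
  classical
  have := abs_eigenvalues_le (G.isHermitian_adjMatrix ℝ)
    (fun i j => by rw [SimpleGraph.adjMatrix_apply]; split_ifs <;> norm_num) hw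
    (fun x => (G.adjMatrix_mulVec_apply x w).trans_le (h x)) i
  rw [← sq_abs, ← Real.sq_sqrt hz]
  exact pow_le_pow_left₀ (abs_nonneg _) this 2

end Bounds

/-! ### The extremal graph `O_s ∨₁ (K_1 ∪ K_{p,q})` -/

/-- The squared singular values `X > y` of the bipartite adjacency matrix of `joinOneK1 s p (b - s)`
as the roots of a quadratic polynomial. -/
theorem exists_sq_singular_values {p b s : ℝ} (hs : 1 ≤ s) (hsb : s ≤ b) (hbp : b ≤ p) :
    ∃ X y : ℝ, 0 ≤ y ∧ y < X ∧ p * b < X ∧ X + y = p * b + s ∧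
      X ^ 2 - (p * b + s) * X + p * s * (b - s) = 0 ∧
      y ^ 2 - (p * b + s) * y + p * s * (b - s) = 0 := by
  -- The quadratic is negative at `p * b` and nonnegative at `p * b + s`.
  set Q : ℝ → ℝ := fun z => z ^ 2 - (p * b + s) * z + p * s * (b - s) with hQ
  have hps : 0 < p * s ^ 2 := by have : 0 < p := by linarith
                                 positivity
  have hpb : s ≤ p * b := by nlinarith
  have h1 : Q (p * b) < 0 := by simp only [hQ]; nlinarith
  have h2 : 0 ≤ Q (p * b + s) := by
    have : 0 ≤ p * s * (b - s) := mul_nonneg (mul_nonneg (by linarith) (by linarith)) (by linarith)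
    simp only [hQ]; nlinarith
  obtain ⟨X, ⟨hX1, hX2⟩, hX⟩ := intermediate_value_Icc (f := Q) (a := p * b) (b := p * b + s)
    (by linarith) (by fun_prop) ⟨h1.le, h2⟩
  have hXlt : p * b < X := lt_of_le_of_ne hX1 fun h => by rw [← h] at hX; linarith
  refine ⟨X, p * b + s - X, by linarith, by linarith, hXlt, by ring, hX, ?_⟩
  simp only [hQ] at hX
  linarith

theorem sum_neighborFinset_eq {V : Type*} [Fintype V] (G : SimpleGraph V) (w : V → ℝ) (x : V)
    [Fintype (G.neighborSet x)] [DecidablePred (G.Adj x)] :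
    ∑ z ∈ G.neighborFinset x, w z = ∑ z, if G.Adj x z then w z else 0 := by
  rw [← Finset.sum_filter]
  congr 1
  ext z
  simp

section Adj

variable {s p q : ℕ}

@[simp] theorem joinOneK1_not_adj_inl (i j : Fin s) :
    ¬ (joinOneK1 s p q).Adj (.inl i) (.inl j) := by
  simp [joinOne]

@[simp] theorem joinOneK1_adj_inl_single (i : Fin s) (j : Fin 1) :
    (joinOneK1 s p q).Adj (.inl i) (.inr (.inl (.inl j))) := by
  simp [joinOne, InFirstPart.left, Subsingleton.elim j 0]

@[simp] theorem joinOneK1_adj_inl_first (i : Fin s) (j : Fin p) :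
    (joinOneK1 s p q).Adj (.inl i) (.inr (.inr (.inl j))) := by
  simp [joinOne, InFirstPart.right]

@[simp] theorem joinOneK1_not_adj_inl_second (i : Fin s) (j : Fin q) :
    ¬ (joinOneK1 s p q).Adj (.inl i) (.inr (.inr (.inr j))) := by
  simp only [joinOne, SimpleGraph.sup_adj, SimpleGraph.fromRel_adj]
  rintro (h | ⟨-, ⟨a, w, h1, h2, h3⟩ | ⟨a, w, h1, h2, h3⟩⟩)
  · simp at h
  · cases h2; cases h3
  · cases h1

@[simp] theorem joinOneK1_adj_single_inl (i : Fin s) (j : Fin 1) :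
    (joinOneK1 s p q).Adj (.inr (.inl (.inl j))) (.inl i) :=
  (joinOneK1_adj_inl_single i j).symm

@[simp] theorem joinOneK1_adj_first_inl (i : Fin s) (j : Fin p) :
    (joinOneK1 s p q).Adj (.inr (.inr (.inl j))) (.inl i) :=
  (joinOneK1_adj_inl_first i j).symm

@[simp] theorem joinOneK1_not_adj_second_inl (i : Fin s) (j : Fin q) :
    ¬ (joinOneK1 s p q).Adj (.inr (.inr (.inr j))) (.inl i) :=
  fun h => joinOneK1_not_adj_inl_second i j h.symm

@[simp] theorem joinOneK1_not_adj_single_inr (j : Fin 1) (x : Fin p ⊕ Fin q) :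
    ¬ (joinOneK1 s p q).Adj (.inr (.inl (.inl j))) (.inr (.inr x)) := by
  simp [joinOne]

@[simp] theorem joinOneK1_not_adj_inr_single (j : Fin 1) (x : Fin p ⊕ Fin q) :
    ¬ (joinOneK1 s p q).Adj (.inr (.inr x)) (.inr (.inl (.inl j))) := by
  simp [joinOne]

@[simp] theorem joinOneK1_not_adj_single (i j : Fin 1) :
    ¬ (joinOneK1 s p q).Adj (.inr (.inl (.inl i))) (.inr (.inl (.inl j))) := by
  simp [joinOne]

@[simp] theorem joinOneK1_adj_inr_inr (x y : Fin p ⊕ Fin q) :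
    (joinOneK1 s p q).Adj (.inr (.inr x)) (.inr (.inr y)) ↔
      (completeBipartiteGraph (Fin p) (Fin q)).Adj x y := by
  simp [joinOne]

end Adj

theorem joinOneK1_exists_adjEigenvalues_eq {s p q : ℕ} (hs : 1 ≤ s) (hp : 1 ≤ p) {r : ℝ}
    (hr : r ≠ 0)
    (h : (r ^ 2) ^ 2 - ((p : ℝ) * (s + q) + s) * r ^ 2 + p * s * q = 0) :
    ∃ i, adjEigenvalues (joinOneK1 s p q) i = r := by
  classical
  have hp0 : (p : ℝ) ≠ 0 := by positivity
  -- The eigenvector is constant on the four classes of vertices.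
  let w : JoinOneVertex s 1 0 p q → ℝ :=
    Sum.elim (fun _ => r) (Sum.elim (fun _ => (s : ℝ))
      (Sum.elim (fun _ => (r ^ 2 - s) / p) (fun _ => (r ^ 2 - s) / r)))
  refine exists_adjEigenvalues_eq _ (w := w) (fun h0 => ?_) ?_
  · have := congrFun h0 (.inr (.inl (.inl 0)))
    simp [w] at this
    omega
  · intro x
    rw [sum_neighborFinset_eq]
    rcases x with i | (i | i) | i | i
    · simp [w, Fintype.sum_sum_type]
      field_simp
      ring
    · simp [w, Fintype.sum_sum_type]
      ring
    · exact i.elim0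
    · simp [w, Fintype.sum_sum_type]
      field_simp
      linear_combination (-1 : ℝ) * h
    · simp [w, Fintype.sum_sum_type]
      field_simp

/-- Four nonzero eigenvalues `±√X`, `±√y` (two, if `y = 0`) already account for the bound. -/
theorem le_estradaIndex_joinOneK1 {s p q : ℕ} (hs : 1 ≤ s) (hp : 1 ≤ p) {X y : ℝ}
    (hy : 0 ≤ y) (hyX : y < X)
    (hX : X ^ 2 - ((p : ℝ) * (s + q) + s) * X + p * s * q = 0)
    (hY : y ^ 2 - ((p : ℝ) * (s + q) + s) * y + p * s * q = 0) :
    (Fintype.card (JoinOneVertex s 1 0 p q) : ℝ) +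
      2 * ((Real.cosh √X - 1) + (Real.cosh √y - 1)) ≤ estradaIndex (joinOneK1 s p q) := by
  have hX0 : 0 < √X := Real.sqrt_pos.2 (hy.trans_lt hyX)
  have hlt : √y < √X := Real.sqrt_lt_sqrt hy hyX
  have key : ∀ z : ℝ, 0 < z → z ^ 2 - ((p : ℝ) * (s + q) + s) * z + p * s * q = 0 →
      (∃ i, adjEigenvalues (joinOneK1 s p q) i = √z) ∧
        ∃ i, adjEigenvalues (joinOneK1 s p q) i = -√z := fun z hz h => by
    have hz' := (Real.sqrt_pos.2 hz).ne'
    exact ⟨joinOneK1_exists_adjEigenvalues_eq hs hp hz' (by rwa [Real.sq_sqrt hz.le]),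
      joinOneK1_exists_adjEigenvalues_eq hs hp (neg_ne_zero.2 hz')
        (by rwa [neg_sq, Real.sq_sqrt hz.le])⟩
  have hkX := key X (hy.trans_lt hyX) hX
  rcases hy.eq_or_lt with h0 | h0
  · have := le_estradaIndex_of_subset (joinOneK1 s p q) {√X, -√X} (by
      intro μ hμ
      rcases Finset.mem_insert.1 hμ with rfl | hμ
      · exact hkX.1
      · rw [Finset.mem_singleton.1 hμ]; exact hkX.2)
    rw [Finset.sum_pair (by linarith)] at this
    rw [← h0, Real.sqrt_zero, Real.cosh_zero, Real.cosh_eq]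
    linarith
  · have hy0 : 0 < √y := Real.sqrt_pos.2 h0
    have hky := key y h0 hY
    have := le_estradaIndex_of_subset (joinOneK1 s p q) {√X, -√X, √y, -√y} (by
      intro μ hμ
      simp only [Finset.mem_insert, Finset.mem_singleton] at hμ
      rcases hμ with rfl | rfl | rfl | rfl
      exacts [hkX.1, hkX.2, hky.1, hky.2])
    rw [Finset.sum_insert, Finset.sum_insert, Finset.sum_pair (by linarith)] at this
    · rw [Real.cosh_eq, Real.cosh_eq]
      linarith
    all_goals
      simp only [Finset.mem_insert, Finset.mem_singleton, not_or]
      refine ⟨?_, ?_⟩ <;> first | exact ⟨by linarith, by linarith⟩ | linarith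

/-! ### Connectivity, minimum degree and edge counts -/

section Connectivity

variable {V : Type*} [Fintype V]

theorem vertexConnectivity_le_of_isVertexCut {G : SimpleGraph V} {S : Finset V}
    (h : IsVertexCut G S) : vertexConnectivity G ≤ #S :=
  Nat.sInf_le (Or.inr ⟨S, h, rfl⟩)

theorem vertexConnectivity_le_card_sub_one (G : SimpleGraph V) :
    vertexConnectivity G ≤ Fintype.card V - 1 :=
  Nat.sInf_le (Or.inl rfl)

theorem le_vertexConnectivity {G : SimpleGraph V} {k : ℕ} (h1 : k ≤ Fintype.card V - 1)
    (h2 : ∀ S : Finset V, IsVertexCut G S → k ≤ #S) : k ≤ vertexConnectivity G := by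
  refine le_csInf ⟨_, Or.inl rfl⟩ ?_
  rintro _ (rfl | ⟨S, hS, rfl⟩)
  exacts [h1, h2 S hS]

theorem exists_isVertexCut {G : SimpleGraph V}
    (h : vertexConnectivity G < Fintype.card V - 1) :
    ∃ S : Finset V, IsVertexCut G S ∧ #S = vertexConnectivity G := by
  have : vertexConnectivity G ∈
      {k | k = Fintype.card V - 1 ∨ ∃ S : Finset V, IsVertexCut G S ∧ #S = k} :=
    Nat.sInf_mem ⟨_, Or.inl rfl⟩
  rcases this with h' | h'
  · omega
  · exact h'

/-- Removing the neighbours of a vertex isolates it. -/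
theorem vertexConnectivity_le_degree (G : SimpleGraph V) (v : V) [Fintype (G.neighborSet v)] :
    vertexConnectivity G ≤ G.degree v := by
  classical
  by_cases h : ∀ x, x = v ∨ G.Adj v x
  · refine (vertexConnectivity_le_card_sub_one G).trans ?_
    have : univ ⊆ insert v (G.neighborFinset v) := fun x _ => by simpa using h x
    have h1 := (Finset.card_le_card this).trans (Finset.card_insert_le _ _)
    rw [SimpleGraph.card_neighborFinset_eq_degree, Finset.card_univ] at h1
    omega
  · push Not at h
    obtain ⟨x, hxv, hx⟩ := h
    rw [← SimpleGraph.card_neighborFinset_eq_degree]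
    refine vertexConnectivity_le_of_isVertexCut fun hc => ?_
    obtain ⟨p⟩ := hc ⟨v, by simp⟩ ⟨x, by simpa using hx⟩
    cases p with
    | nil => exact hxv rfl
    | @cons _ y _ hy _ => exact y.2 (by simpa using hy)

/-- The two sides of a vertex cut: a nonempty set `C` and its complement outside `S` have no edges
between them. -/
theorem exists_of_isVertexCut {G : SimpleGraph V} {S : Finset V} (h : IsVertexCut G S) :
    open Classical in
    ∃ C D : Finset V, C.Nonempty ∧ D.Nonempty ∧ Disjoint S C ∧ Disjoint S D ∧ Disjoint C D ∧
      S ∪ C ∪ D = univ ∧ ∀ x ∈ C, ∀ y ∈ D, ¬ G.Adj x y := by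
  classical
  unfold IsVertexCut SimpleGraph.Preconnected at h
  push Not at h
  obtain ⟨u, w, huw⟩ := h
  let R : V → Prop := fun x => ∃ hx : x ∉ S, (G.induce {x | x ∉ S}).Reachable u ⟨x, hx⟩
  refine ⟨univ.filter R, univ.filter fun x => x ∉ S ∧ ¬ R x, ⟨u, ?_⟩, ⟨w, ?_⟩, ?_, ?_, ?_, ?_, ?_⟩
  · exact Finset.mem_filter.2 ⟨mem_univ _, u.2, SimpleGraph.Reachable.refl u⟩
  · simp only [mem_filter, mem_univ, true_and]
    exact ⟨w.2, fun ⟨_, h⟩ => huw h⟩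
  · refine Finset.disjoint_left.2 fun x hx hx' => ?_
    exact ((Finset.mem_filter.1 hx').2.1) hx
  · refine Finset.disjoint_left.2 fun x hx hx' => ?_
    exact ((Finset.mem_filter.1 hx').2.1) hx
  · refine Finset.disjoint_left.2 fun x hx hx' => ?_
    exact (Finset.mem_filter.1 hx').2.2 (Finset.mem_filter.1 hx).2
  · ext x
    simp only [mem_union, mem_filter, mem_univ, true_and, iff_true]
    tauto
  · intro x hx y hy hxy
    obtain ⟨hxS, hr⟩ := (Finset.mem_filter.1 hx).2
    obtain ⟨hyS, hnr⟩ := (Finset.mem_filter.1 hy).2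
    refine hnr ⟨hyS, hr.trans (SimpleGraph.Adj.reachable ?_)⟩
    exact hxy

/-- `A` and its complement form a bipartition of `G`. -/
def IsBipartition (G : SimpleGraph V) (A : Finset V) : Prop :=
  ∀ x y, G.Adj x y → (x ∈ A ↔ y ∉ A)

theorem exists_isBipartition {G : SimpleGraph V} (hG : G.IsBipartite) (v : V) :
    ∃ A, v ∈ A ∧ IsBipartition G A := by
  classical
  obtain ⟨c⟩ := hG
  refine ⟨univ.filter fun x => c x = c v, by simp, fun x y h => ?_⟩
  have := c.valid h
  simp only [mem_filter, mem_univ, true_and]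
  omega

open Classical in
theorem IsBipartition.compl {G : SimpleGraph V} {A : Finset V} (h : IsBipartition G A) :
    IsBipartition G Aᶜ := fun x y hxy => by
  have := h x y hxy
  simp only [mem_compl]
  tauto

open Classical in
theorem IsBipartition.neighborFinset_subset {G : SimpleGraph V} {A : Finset V}
    (h : IsBipartition G A) {x : V} (hx : x ∈ A) : G.neighborFinset x ⊆ Aᶜ := fun y hy => by
  rw [SimpleGraph.mem_neighborFinset] at hy
  simpa using (h x y hy).1 hx

open Classical in
theorem IsBipartition.neighborFinset_subset_of_notMem {G : SimpleGraph V} {A : Finset V}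
    (h : IsBipartition G A) {x : V} (hx : x ∉ A) : G.neighborFinset x ⊆ A := by
  simpa using h.compl.neighborFinset_subset (x := x) (by simpa using hx)

open Classical in
theorem IsBipartition.sum_degrees {G : SimpleGraph V} {A : Finset V} (h : IsBipartition G A) :
    ∑ x ∈ A, G.degree x = #G.edgeFinset := by
  have hw : G.IsBipartiteWith (A : Set V) (Aᶜ : Finset V) := by
    refine ⟨Finset.disjoint_coe.2 disjoint_compl_right, fun x y hxy => ?_⟩
    have := h x y hxy
    simp only [mem_coe, mem_compl]
    tauto
  exact SimpleGraph.isBipartiteWith_sum_degrees_eq_card_edges hw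

open Classical in
/-- A part `C` of `G` that is separated by `S` meets both sides of the bipartition in more vertices
than the opposite side of `S` has, if all degrees exceed `#S`. -/
theorem card_inter_lt_of_degree_gt {G : SimpleGraph V} {A S C : Finset V} (hA : IsBipartition G A)
    (hC : C.Nonempty) (hCS : ∀ x ∈ C, G.neighborFinset x ⊆ S ∪ C)
    (hdeg : ∀ x, #S < G.degree x) :
    #(S ∩ A) < #(C ∩ Aᶜ) ∧ #(S ∩ Aᶜ) < #(C ∩ A) := by
  have step : ∀ B : Finset V, IsBipartition G B → ∀ x ∈ C ∩ B,
      #(S ∩ B) < #(C ∩ Bᶜ) := fun B hB x hx => by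
    have hxC := (Finset.mem_inter.1 hx).1
    have hsub : G.neighborFinset x ⊆ (S ∩ Bᶜ) ∪ (C ∩ Bᶜ) := by
      rw [← Finset.union_inter_distrib_right]
      exact Finset.subset_inter (hCS x hxC) (hB.neighborFinset_subset (Finset.mem_inter.1 hx).2)
    have h1 := (Finset.card_le_card hsub).trans (Finset.card_union_le _ _)
    have h2 := hdeg x
    rw [SimpleGraph.card_neighborFinset_eq_degree] at h1
    have h3 : #(S ∩ B) + #(S ∩ Bᶜ) = #S := by
      rw [← Finset.sdiff_eq_inter_compl, Finset.card_inter_add_card_sdiff]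
    omega
  have hAc : IsBipartition G Aᶜ := hA.compl
  obtain ⟨x, hx⟩ := hC
  by_cases hxA : x ∈ A
  · have h1 := step A hA x (by simp [hx, hxA])
    obtain ⟨y, hy⟩ : (C ∩ Aᶜ).Nonempty := Finset.card_pos.1 (by omega)
    have h2 := step Aᶜ hAc y hy
    rw [compl_compl] at h2
    exact ⟨h1, h2⟩
  · have h1 := step Aᶜ hAc x (by simp [hx, hxA])
    rw [compl_compl] at h1
    obtain ⟨y, hy⟩ : (C ∩ A).Nonempty := Finset.card_pos.1 (by omega)
    exact ⟨step A hA y hy, h1⟩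

/-- Here `σ`, `a₁`, `a₂` are the sizes of the intersections of one side of the bipartition with a
vertex cut and with the two parts left by it, and `τ`, `b₁`, `b₂` those for the other side. -/
theorem four_mul_le_of_sizes {a₁ a₂ b₁ b₂ σ τ m n : ℕ} (h1 : σ < b₁) (h2 : σ < b₂) (h3 : τ < a₁)
    (h4 : τ < a₂) (hn : (σ + a₁ + a₂) + (τ + b₁ + b₂) = n)
    (hm : m ≤ σ * (τ + b₁ + b₂) + a₁ * (τ + b₁) + a₂ * (τ + b₂)) :
    4 * m + 2 * n ≤ n * n := by
  subst hn
  obtain ⟨b₁, rfl⟩ := Nat.exists_eq_add_of_lt h1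
  obtain ⟨b₂, rfl⟩ := Nat.exists_eq_add_of_lt h2
  obtain ⟨a₁, rfl⟩ := Nat.exists_eq_add_of_lt h3
  obtain ⟨a₂, rfl⟩ := Nat.exists_eq_add_of_lt h4
  refine (Nat.add_le_add_right (Nat.mul_le_mul_left 4 hm) _).trans ?_
  zify
  -- The product of the two sides is at most `n ^ 2 / 4`, and `a * b ≥ a + b - 1` for the missing edges.
  nlinarith [sq_nonneg ((σ : ℤ) + (τ + a₁ + 1) + (τ + a₂ + 1) - (τ + (σ + b₁ + 1) + (σ + b₂ + 1))),
    mul_nonneg (Int.natCast_nonneg (τ + a₁)) (Int.natCast_nonneg (σ + b₂)),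
    mul_nonneg (Int.natCast_nonneg (τ + a₂)) (Int.natCast_nonneg (σ + b₁))]

open Classical in
/-- If all degrees exceed the connectivity, a minimum vertex cut leaves two parts that both meet
both sides of the bipartition, and the edges missing between them make `G` sparse. -/
theorem four_mul_card_edgeFinset_le {G : SimpleGraph V} (hG : G.IsBipartite)
    (hdeg : ∀ x, vertexConnectivity G < G.degree x)
    (hκ : vertexConnectivity G < Fintype.card V - 1) :
    4 * #G.edgeFinset + 2 * Fintype.card V ≤ Fintype.card V * Fintype.card V := by
  obtain ⟨S, hS, hSc⟩ := exists_isVertexCut hκ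
  obtain ⟨C, D, hC, hD, hSC, hSD, hCD, hun, hadj⟩ := exists_of_isVertexCut hS
  obtain ⟨A, -, hA⟩ := exists_isBipartition hG hC.choose
  have hCS : ∀ x ∈ C, G.neighborFinset x ⊆ S ∪ C := fun x hx y hy => by
    have h1 : y ∈ S ∪ C ∪ D := hun ▸ mem_univ y
    rcases Finset.mem_union.1 h1 with h | h
    · exact h
    · exact absurd (by simpa using hy) (hadj x hx y h)
  have hDS : ∀ x ∈ D, G.neighborFinset x ⊆ S ∪ D := fun x hx y hy => by
    have h1 : y ∈ S ∪ C ∪ D := hun ▸ mem_univ y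
    rcases Finset.mem_union.1 h1 with h | h
    · rcases Finset.mem_union.1 h with h | h
      · exact Finset.mem_union_left _ h
      · exact absurd (by simpa using hy) (fun h' => hadj y h x hx (G.adj_symm h'))
    · exact Finset.mem_union_right _ h
  have hdeg' : ∀ x, #S < G.degree x := fun x => hSc ▸ hdeg x
  obtain ⟨hc1, hc2⟩ := card_inter_lt_of_degree_gt hA hC hCS hdeg'
  obtain ⟨hd1, hd2⟩ := card_inter_lt_of_degree_gt hA hD hDS hdeg'
  have hsplit : ∀ B : Finset V, B = (S ∩ B) ∪ (C ∩ B) ∪ (D ∩ B) := fun B => by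
    rw [← Finset.union_inter_distrib_right, ← Finset.union_inter_distrib_right, hun,
      Finset.univ_inter]
  have hd1' : ∀ B : Finset V, Disjoint (S ∩ B) (C ∩ B) := fun B =>
    hSC.mono Finset.inter_subset_left Finset.inter_subset_left
  have hd2' : ∀ B : Finset V, Disjoint ((S ∩ B) ∪ (C ∩ B)) (D ∩ B) := fun B =>
    (Finset.disjoint_union_left.2 ⟨hSD, hCD⟩).mono
      (Finset.union_subset_union Finset.inter_subset_left Finset.inter_subset_left)
      Finset.inter_subset_left
  have hcard : ∀ B : Finset V, #B = #(S ∩ B) + #(C ∩ B) + #(D ∩ B) := fun B => by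
    conv_lhs => rw [hsplit B]
    rw [Finset.card_union_of_disjoint (hd2' B), Finset.card_union_of_disjoint (hd1' B)]
  have hbound : ∀ T : Finset V, ∀ x ∈ A, G.neighborFinset x ⊆ T → G.degree x ≤ #(T ∩ Aᶜ) :=
    fun T x hx hT => by
      rw [← SimpleGraph.card_neighborFinset_eq_degree]
      exact Finset.card_le_card (Finset.subset_inter hT (hA.neighborFinset_subset hx))
  refine four_mul_le_of_sizes hc1 hd1 hc2 hd2 (n := Fintype.card V) ?_ ?_
  · rw [← hcard A, ← hcard Aᶜ, Finset.card_add_card_compl]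
  · rw [← hA.sum_degrees]
    conv_lhs => rw [hsplit A]
    rw [Finset.sum_union (hd2' A), Finset.sum_union (hd1' A)]
    have e1 : ∀ T : Finset V, #((S ∪ T) ∩ Aᶜ) ≤ #(S ∩ Aᶜ) + #(T ∩ Aᶜ) := fun T => by
      rw [Finset.union_inter_distrib_right]
      exact Finset.card_union_le _ _
    refine Nat.add_le_add (Nat.add_le_add ?_ ?_) ?_
    · refine (Finset.sum_le_card_nsmul _ _ _ fun x hx => ?_).trans_eq (smul_eq_mul _ _)
      rw [← hcard Aᶜ]
      simpa using hbound univ x (Finset.mem_inter.1 hx).2 (Finset.subset_univ _)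
    · refine (Finset.sum_le_card_nsmul _ _ _ fun x hx => ?_).trans_eq (smul_eq_mul _ _)
      exact (hbound _ x (Finset.mem_inter.1 hx).2 (hCS x (Finset.mem_inter.1 hx).1)).trans (e1 C)
    · refine (Finset.sum_le_card_nsmul _ _ _ fun x hx => ?_).trans_eq (smul_eq_mul _ _)
      exact (hbound _ x (Finset.mem_inter.1 hx).2 (hDS x (Finset.mem_inter.1 hx).1)).trans (e1 D)

end Connectivity

/-! ### Graphs with a vertex of minimum possible degree -/

section SmallDegree

variable {V : Type*} [Fintype V]

open Classical in
theorem card_edgeFinset_le_of_mem {G : SimpleGraph V} {A : Finset V} (hA : IsBipartition G A)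
    {v : V} (hv : v ∈ A) : #G.edgeFinset ≤ G.degree v + #(A.erase v) * #Aᶜ := by
  rw [← hA.sum_degrees, ← Finset.add_sum_erase A _ hv]
  refine Nat.add_le_add_left
    ((Finset.sum_le_card_nsmul _ _ _ fun x hx => ?_).trans_eq (smul_eq_mul _ _)) _
  rw [← SimpleGraph.card_neighborFinset_eq_degree]
  exact Finset.card_le_card (hA.neighborFinset_subset (Finset.mem_of_mem_erase hx))

open Classical in
theorem neighborFinset_eq_of_card_edgeFinset_eq {G : SimpleGraph V} {A : Finset V}
    (hA : IsBipartition G A) {v : V} (hv : v ∈ A)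
    (h : #G.edgeFinset = G.degree v + #(A.erase v) * #Aᶜ) {x : V} (hx : x ∈ A.erase v) :
    G.neighborFinset x = Aᶜ := by
  have hle : ∀ y ∈ A.erase v, G.degree y ≤ #Aᶜ := fun y hy => by
    rw [← SimpleGraph.card_neighborFinset_eq_degree]
    exact Finset.card_le_card (hA.neighborFinset_subset (Finset.mem_of_mem_erase hy))
  rw [← hA.sum_degrees, ← Finset.add_sum_erase A _ hv, ← smul_eq_mul, ← Finset.sum_const] at h
  have := (Finset.sum_eq_sum_iff_of_le hle).1 (Nat.add_left_cancel h) x hx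
  refine Finset.eq_of_subset_of_card_le
    (hA.neighborFinset_subset (Finset.mem_of_mem_erase hx)) ?_
  rw [SimpleGraph.card_neighborFinset_eq_degree, this]

open Classical in
/-- The spectral bound for a spanning subgraph of `O_s ∨₁ (K_1 ∪ K_{c,e-s})`, where `v` is the vertex
of `K_1`: the test vector is the eigenvector of that graph when `z` is a root of the quadratic. -/
theorem adjEigenvalues_sq_le_of_mem {G : SimpleGraph V} {A : Finset V} (hA : IsBipartition G A)
    {v : V} (hv : v ∈ A) (hv0 : 0 < G.degree v) {z : ℝ} (hz : (G.degree v : ℝ) < z)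
    (hQ : 0 ≤ z ^ 2 - (#(A.erase v) * #Aᶜ + G.degree v : ℝ) * z +
      #(A.erase v) * G.degree v * (#Aᶜ - G.degree v)) (i : V) :
    adjEigenvalues G i ^ 2 ≤ z := by
  set s : ℝ := (G.degree v : ℝ) with hs
  set c : ℝ := (#(A.erase v) : ℝ) with hc
  set e : ℝ := (#Aᶜ : ℝ) with he
  have hs0 : 0 < s := Nat.cast_pos.2 hv0
  have hz0 : 0 < z := hs0.trans hz
  have hr0 : 0 < √z := Real.sqrt_pos.2 hz0
  have hrr : √z * √z = z := Real.mul_self_sqrt hz0.le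
  have hcz : c * ((z - s) / c) ≤ z - s := by
    rcases eq_or_ne c 0 with h | h
    · rw [h]; simp [hz.le]
    · rw [mul_div_cancel₀ _ h]
  let w : V → ℝ := fun x => if x = v then s else if x ∈ A then (z - s) / c else
    if G.Adj v x then √z else (z - s) / √z
  have hwv : w v = s := by simp [w]
  have hwA : ∀ x ∈ A.erase v, w x = (z - s) / c := fun x hx => by
    simp [w, (Finset.mem_erase.1 hx).1, (Finset.mem_erase.1 hx).2]
  have hwO : ∀ x ∈ G.neighborFinset v, w x = √z := fun x hx => by
    have h1 := hA.neighborFinset_subset hv hx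
    have h2 : x ≠ v := fun h => by rw [h] at h1; simp [hv] at h1
    simp [w, h2, Finset.mem_compl.1 h1, (G.mem_neighborFinset v x).1 hx]
  have hwQ : ∀ x ∈ Aᶜ \ G.neighborFinset v, w x = (z - s) / √z := fun x hx => by
    obtain ⟨h1, h3⟩ := Finset.mem_sdiff.1 hx
    have h2 : x ≠ v := fun h => by rw [h] at h1; simp [hv] at h1
    simp only [SimpleGraph.mem_neighborFinset] at h3
    simp [w, h2, Finset.mem_compl.1 h1, h3]
  have hcpos : ∀ x ∈ A.erase v, 0 < c := fun x hx => by
    rw [hc]; exact_mod_cast Finset.card_pos.2 ⟨x, hx⟩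
  have hcov : ∀ x, x = v ∨ x ∈ A.erase v ∨ x ∈ G.neighborFinset v ∨
      x ∈ Aᶜ \ G.neighborFinset v := fun x => by
    simp only [mem_erase, mem_sdiff, mem_compl]
    tauto
  have hw : ∀ x, 0 < w x := fun x => by
    rcases hcov x with rfl | hx | hx | hx
    · rwa [hwv]
    · rw [hwA x hx]; exact div_pos (sub_pos.2 hz) (hcpos x hx)
    · rwa [hwO x hx]
    · rw [hwQ x hx]; exact div_pos (sub_pos.2 hz) hr0
  have hsumA : ∑ y ∈ A.erase v, w y ≤ z - s := by
    rw [Finset.sum_congr rfl hwA, Finset.sum_const, nsmul_eq_mul]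
    exact hcz
  have hsub := hA.neighborFinset_subset hv
  have hsumB : ∑ y ∈ Aᶜ, w y = (e - s) * ((z - s) / √z) + s * √z := by
    rw [← Finset.sum_sdiff hsub, Finset.sum_congr rfl hwQ, Finset.sum_congr rfl hwO,
      Finset.sum_const, Finset.sum_const, nsmul_eq_mul, nsmul_eq_mul,
      Finset.card_sdiff_of_subset hsub, Nat.cast_sub (Finset.card_le_card hsub),
      SimpleGraph.card_neighborFinset_eq_degree]
  have hmono : ∀ {S T : Finset V}, S ⊆ T → ∑ y ∈ S, w y ≤ ∑ y ∈ T, w y := fun h =>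
    Finset.sum_le_sum_of_subset_of_nonneg h fun y _ _ => (hw y).le
  refine adjEigenvalues_sq_le G hw hz0.le (fun x => ?_) i
  rcases hcov x with rfl | hx | hx | hx
  · rw [Finset.sum_congr rfl hwO, hwv, Finset.sum_const, nsmul_eq_mul,
      SimpleGraph.card_neighborFinset_eq_degree, mul_comm]
  · refine (hmono (hA.neighborFinset_subset (Finset.mem_of_mem_erase hx))).trans ?_
    have hc0 := hcpos x hx
    rw [hsumB, hwA x hx, ← sub_nonneg]
    have : √z * ((z - s) / c) - ((e - s) * ((z - s) / √z) + s * √z) =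
        (z ^ 2 - (c * e + s) * z + c * s * (e - s)) / (c * √z) := by
      field_simp
      rw [sq, hrr]
      ring
    rw [this]
    positivity
  · have hxA := Finset.mem_compl.1 (hsub hx)
    refine (hmono (hA.neighborFinset_subset_of_notMem hxA)).trans ?_
    rw [← Finset.add_sum_erase A _ hv, hwv, hwO x hx, hrr]
    linarith
  · obtain ⟨h1, h3⟩ := Finset.mem_sdiff.1 hx
    have hxA := Finset.mem_compl.1 h1
    have : G.neighborFinset x ⊆ A.erase v := fun y hy => by
      refine Finset.mem_erase.2 ⟨fun h => h3 ?_, hA.neighborFinset_subset_of_notMem hxA hy⟩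
      rw [SimpleGraph.mem_neighborFinset] at hy ⊢
      exact h ▸ hy.symm
    refine (hmono this).trans ?_
    rw [hwQ x hx, mul_div_cancel₀ _ hr0.ne']
    exact hsumA

theorem exists_equiv_of_card_fiber_eq {W K : Type*} [Fintype W] [DecidableEq K] (f : V → K)
    (g : W → K)
    (h : ∀ k, Fintype.card {x // f x = k} = Fintype.card {x // g x = k}) :
    ∃ e : V ≃ W, ∀ x, g (e x) = f x := by
  let φ : ∀ k, {x // f x = k} ≃ {x // g x = k} := fun k => Fintype.equivOfCardEq (h k)
  refine ⟨(Equiv.sigmaFiberEquiv f).symm.trans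
    ((Equiv.sigmaCongrRight φ).trans (Equiv.sigmaFiberEquiv g)), fun x => ?_⟩
  exact (φ (f x) ⟨x, rfl⟩).2

/-- The class of a vertex of `joinOneK1 s p q`: `0` for `K_1`, `1` and `2` for the parts of size `p`
and `q`, `3` for `O_s`. -/
def joinOneClass {s p q : ℕ} : JoinOneVertex s 1 0 p q → Fin 4 :=
  Sum.elim (fun _ => 3) (Sum.elim (fun _ => 0) (Sum.elim (fun _ => 1) (fun _ => 2)))

theorem joinOneK1_adj_iff {s p q : ℕ} (x y : JoinOneVertex s 1 0 p q) :
    (joinOneK1 s p q).Adj x y ↔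
      (joinOneClass x, joinOneClass y) ∈
        ({(0, 3), (3, 0), (1, 3), (3, 1), (1, 2), (2, 1)} : Finset (Fin 4 × Fin 4)) := by
  rcases x with i | (i | i) | i | i <;> rcases y with j | (j | j) | j | j <;>
    first | exact i.elim0 | exact j.elim0 | simp [joinOneClass]

open Classical in
theorem nonempty_iso_joinOneK1 {G : SimpleGraph V} {A : Finset V} (hA : IsBipartition G A)
    {v : V} (hv : v ∈ A) {s p q : ℕ} (hs : G.degree v = s) (hp : #(A.erase v) = p)
    (hq : #Aᶜ = s + q) (h : ∀ x ∈ A.erase v, G.neighborFinset x = Aᶜ) :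
    Nonempty (G ≃g joinOneK1 s p q) := by
  let f : V → Fin 4 := fun x => if x = v then 0 else if x ∈ A then 1 else if G.Adj v x then 3 else 2
  have hsub := hA.neighborFinset_subset hv
  have hvB : v ∉ Aᶜ := by simp [hv]
  have f0 : univ.filter (fun x => f x = 0) = {v} := by
    ext x
    simp only [f, mem_filter, mem_univ, true_and, mem_singleton]
    split_ifs <;> simp_all
  have f1 : univ.filter (fun x => f x = 1) = A.erase v := by
    ext x
    simp only [f, mem_filter, mem_univ, true_and, mem_erase]
    split_ifs <;> simp_all
  have f3 : univ.filter (fun x => f x = 3) = G.neighborFinset v := by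
    ext x
    have h1 := hA v x
    simp only [f, mem_filter, mem_univ, true_and, SimpleGraph.mem_neighborFinset]
    split_ifs <;> simp_all
  have f2 : univ.filter (fun x => f x = 2) = Aᶜ \ G.neighborFinset v := by
    ext x
    simp only [f, mem_filter, mem_univ, true_and, mem_sdiff, mem_compl,
      SimpleGraph.mem_neighborFinset]
    split_ifs <;> simp_all
  obtain ⟨e, he⟩ := exists_equiv_of_card_fiber_eq f (joinOneClass (s := s) (p := p) (q := q))
    (fun k => by
      rw [Fintype.card_subtype, Fintype.card_subtype]
      have hk : ∀ k : Fin 4, k = 0 ∨ k = 1 ∨ k = 2 ∨ k = 3 := by decide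
      rcases hk k with rfl | rfl | rfl | rfl
      · rw [f0]
        rw [Finset.card_filter]
        simp [joinOneClass, Fintype.sum_sum_type]
      · rw [f1, hp]
        rw [Finset.card_filter]
        simp [joinOneClass, Fintype.sum_sum_type]
      · rw [f2, Finset.card_sdiff_of_subset hsub, SimpleGraph.card_neighborFinset_eq_degree, hs, hq]
        rw [Finset.card_filter]
        simp [joinOneClass, Fintype.sum_sum_type]
      · rw [f3, SimpleGraph.card_neighborFinset_eq_degree, hs]
        rw [Finset.card_filter]
        simp [joinOneClass, Fintype.sum_sum_type])
  refine ⟨⟨e, fun {x y} => ?_⟩⟩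
  rw [joinOneK1_adj_iff, he, he]
  have hadj : ∀ x y, x ∈ A.erase v → (G.Adj x y ↔ y ∉ A) := fun x y hx => by
    rw [← SimpleGraph.mem_neighborFinset, h x hx, mem_compl]
  have hxy := hA x y
  have hvx := hA v x
  have hvy := hA v y
  by_cases hxv : x = v
  · subst hxv
    by_cases hyv : y = x
    · subst hyv; simp [f]
    · by_cases hyA : y ∈ A
      · simp [f, hyv, hyA]; tauto
      · by_cases hadj' : G.Adj x y <;> simp [f, hyv, hyA, hadj']
  · by_cases hyv : y = v
    · subst hyv
      by_cases hxA : x ∈ A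
      · simp [f, hxv, hxA]; tauto
      · by_cases hadj' : G.Adj y x <;> simp [f, hxv, hxA, hadj', G.adj_comm x y]
    · by_cases hxA : x ∈ A <;> by_cases hyA : y ∈ A
      · simp [f, hxv, hyv, hxA, hyA]; tauto
      · have := (hadj x y (by simp [hxv, hxA])).2 hyA
        by_cases hadj' : G.Adj v y <;> simp [f, hxv, hyv, hxA, hyA, hadj', this]
      · have := ((hadj y x (by simp [hyv, hyA])).2 hxA).symm
        by_cases hadj' : G.Adj v x <;> simp [f, hxv, hyv, hxA, hyA, hadj', this]
      · have : ¬ G.Adj x y := by tauto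
        by_cases hadj' : G.Adj v x <;> by_cases hadj'' : G.Adj v y <;>
          simp [f, hxv, hyv, hxA, hyA, hadj', hadj'', this]

end SmallDegree

/-! ### The extremal graphs belong to the class -/

section Membership

theorem not_isVertexCut_of_reachable {V : Type*} {G : SimpleGraph V} {S : Finset V} {o : V}
    (ho : o ∉ S)
    (h : ∀ x (hx : x ∉ S), (G.induce {x | x ∉ S}).Reachable ⟨x, hx⟩ ⟨o, ho⟩) :
    ¬ IsVertexCut G S := fun hS => hS fun x y => (h x.1 x.2).trans (h y.1 y.2).symm

theorem exists_notMem_of_card_lt {V : Type*} {k : ℕ} {S : Finset V} (f : Fin k → V)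
    (hf : Function.Injective f) (h : #S < k) : ∃ i, f i ∉ S := by
  classical
  by_contra hne
  push Not at hne
  have := Finset.card_le_card_of_injOn f (s := univ) (fun i _ => hne i) hf.injOn
  rw [Finset.card_univ, Fintype.card_fin] at this
  omega

theorem joinOneK1_isBipartite (s p q : ℕ) : (joinOneK1 s p q).IsBipartite := by
  refine ⟨SimpleGraph.Coloring.mk
    (fun x => if joinOneClass x = 0 ∨ joinOneClass x = 1 then (0 : Fin 2) else 1) ?_⟩
  intro x y h
  rw [joinOneK1_adj_iff] at h
  simp only [mem_insert, mem_singleton, Prod.mk.injEq] at h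
  rcases h with ⟨h1, h2⟩ | ⟨h1, h2⟩ | ⟨h1, h2⟩ | ⟨h1, h2⟩ | ⟨h1, h2⟩ | ⟨h1, h2⟩ <;>
    rw [h1, h2] <;> decide

theorem vertexConnectivity_joinOneK1 {s p q : ℕ} (hs : 1 ≤ s) (hsp : s ≤ p) :
    vertexConnectivity (joinOneK1 s p q) = s := by
  classical
  refine le_antisymm ?_ (le_vertexConnectivity ?_ fun S hS => ?_)
  · refine (vertexConnectivity_le_degree _ (.inr (.inl (.inl 0)))).trans_eq ?_
    rw [← SimpleGraph.card_neighborFinset_eq_degree, SimpleGraph.neighborFinset_eq_filter,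
      Finset.card_filter]
    simp only [Fintype.sum_sum_type]
    simp
  · simp
    omega
  · by_contra hlt
    rw [not_le] at hlt
    obtain ⟨i, hi⟩ := exists_notMem_of_card_lt
      (fun i : Fin s => (Sum.inl i : JoinOneVertex s 1 0 p q)) Sum.inl_injective hlt
    obtain ⟨j, hj⟩ := exists_notMem_of_card_lt
      (fun j : Fin p => (Sum.inr (.inr (.inl j)) : JoinOneVertex s 1 0 p q))
      (Sum.inr_injective.comp (Sum.inr_injective.comp Sum.inl_injective)) (hlt.trans_le hsp)
    have step : ∀ {x y : JoinOneVertex s 1 0 p q} (hx : x ∉ S) (hy : y ∉ S),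
        (joinOneK1 s p q).Adj x y →
        ((joinOneK1 s p q).induce {x | x ∉ S}).Reachable ⟨x, hx⟩ ⟨y, hy⟩ :=
      fun hx hy h => SimpleGraph.Adj.reachable h
    have hji := step hj hi (by simp)
    refine not_isVertexCut_of_reachable hi (fun x hx => ?_) hS
    rcases x with k | (k | k) | k | k
    · exact (step hx hj (by simp)).trans hji
    · exact step hx hi (by simp)
    · exact k.elim0
    · exact step hx hi (by simp)
    · exact (step hx hj (by simp)).trans hji

theorem inClass_joinOneK1 {n s p q : ℕ} (hs : 1 ≤ s) (hsp : s ≤ p) (hn : s + (1 + (p + q)) = n) :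
    InClass n s (joinOneK1 s p q) := by
  refine ⟨?_, joinOneK1_isBipartite s p q, vertexConnectivity_joinOneK1 hs hsp⟩
  simpa using hn

theorem vertexConnectivity_completeBipartiteGraph {s : ℕ} (hs : 1 ≤ s) :
    vertexConnectivity (completeBipartiteGraph (Fin s) (Fin s)) = s := by
  classical
  refine le_antisymm ?_ (le_vertexConnectivity ?_ fun S hS => ?_)
  · refine (vertexConnectivity_le_degree _ (.inl ⟨0, hs⟩)).trans_eq ?_
    rw [← SimpleGraph.card_neighborFinset_eq_degree, SimpleGraph.neighborFinset_eq_filter,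
      Finset.card_filter]
    simp only [Fintype.sum_sum_type]
    simp
  · simp
    omega
  · by_contra hlt
    rw [not_le] at hlt
    obtain ⟨i, hi⟩ := exists_notMem_of_card_lt
      (fun i : Fin s => (Sum.inl i : Fin s ⊕ Fin s)) Sum.inl_injective hlt
    obtain ⟨j, hj⟩ := exists_notMem_of_card_lt
      (fun j : Fin s => (Sum.inr j : Fin s ⊕ Fin s)) Sum.inr_injective hlt
    have step : ∀ {x y : Fin s ⊕ Fin s} (hx : x ∉ S) (hy : y ∉ S),
        (completeBipartiteGraph (Fin s) (Fin s)).Adj x y →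
        ((completeBipartiteGraph (Fin s) (Fin s)).induce {x | x ∉ S}).Reachable
          ⟨x, hx⟩ ⟨y, hy⟩ :=
      fun hx hy h => SimpleGraph.Adj.reachable h
    refine not_isVertexCut_of_reachable hi (fun x hx => ?_) hS
    rcases x with k | k
    · exact (step hx hj (by simp)).trans (step hj hi (by simp))
    · exact step hx hi (by simp)

theorem inClass_completeBipartiteGraph {s : ℕ} (hs : 1 ≤ s) :
    InClass (2 * s) s (completeBipartiteGraph (Fin s) (Fin s)) := by
  refine ⟨by simp [two_mul], ?_, vertexConnectivity_completeBipartiteGraph hs⟩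
  exact ⟨SimpleGraph.Coloring.mk (Sum.elim (fun _ => (0 : Fin 2)) fun _ => 1) (by
    rintro (i | i) (j | j) h <;> simp at h ⊢)⟩

end Membership

/-! ### Maximality -/

section Maximality

variable {V : Type*} [Fintype V]

/-- The minimum degree is at least `s`, which on `2 * s` vertices leaves only `K_{s,s}`. -/
theorem nonempty_iso_completeBipartiteGraph {s : ℕ} (hs : 1 ≤ s) {G : SimpleGraph V}
    (hG : InClass (2 * s) s G) : Nonempty (G ≃g completeBipartiteGraph (Fin s) (Fin s)) := by
  classical
  obtain ⟨hcard, hbip, hκ⟩ := hG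
  have hdeg : ∀ x, s ≤ #(G.neighborFinset x) := fun x => by
    rw [SimpleGraph.card_neighborFinset_eq_degree]
    exact hκ ▸ vertexConnectivity_le_degree G x
  have : 0 < Fintype.card V := by omega
  obtain ⟨v⟩ := Fintype.card_pos_iff.1 this
  obtain ⟨A, hv, hA⟩ := exists_isBipartition hbip v
  have h1 : s ≤ #Aᶜ := (hdeg v).trans (Finset.card_le_card (hA.neighborFinset_subset hv))
  obtain ⟨w, hw⟩ : Aᶜ.Nonempty := Finset.card_pos.1 (by omega)
  have h2 : s ≤ #A := (hdeg w).trans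
    (Finset.card_le_card (hA.neighborFinset_subset_of_notMem (Finset.mem_compl.1 hw)))
  have h3 : #A + #Aᶜ = 2 * s := by rw [Finset.card_add_card_compl, hcard]
  have hN : ∀ x ∈ A, G.neighborFinset x = Aᶜ := fun x hx =>
    Finset.eq_of_subset_of_card_le (hA.neighborFinset_subset hx) (by have := hdeg x; omega)
  have hadj : ∀ x ∈ A, ∀ y ∉ A, G.Adj x y := fun x hx y hy => by
    rw [← SimpleGraph.mem_neighborFinset, hN x hx, mem_compl]
    exact hy
  obtain ⟨e, he⟩ := exists_equiv_of_card_fiber_eq (fun x => decide (x ∈ A))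
    (fun x : Fin s ⊕ Fin s => x.isLeft) (fun k => by
      rw [Fintype.card_subtype, Fintype.card_subtype]
      cases k
      · have : univ.filter (fun x => decide (x ∈ A) = false) = Aᶜ := by ext; simp
        rw [this, Finset.card_filter]
        simp only [Fintype.sum_sum_type]
        simp
        omega
      · have : univ.filter (fun x => decide (x ∈ A) = true) = A := by ext; simp
        rw [this, Finset.card_filter]
        simp only [Fintype.sum_sum_type]
        simp
        omega)
  refine ⟨⟨e, fun {x y} => ?_⟩⟩
  have hx := he x
  have hy := he y
  have hxy := hA x y
  rcases hex : e x with i | i <;> rcases hey : e y with j | j <;> rw [hex] at hx <;>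
    rw [hey] at hy <;> simp at hx hy <;> simp
  · tauto
  · exact hadj x hx y hy
  · exact (hadj y hy x hx).symm
  · tauto

/-- The quadratic of `O_s ∨₁ (K_1 ∪ K_{c,e-s})` is positive at the squared spectral radius `X` of the
balanced graph, unless `c` is the balanced value `p`. -/
theorem quadratic_pos_of_ne {p b s c e : ℕ} {X : ℝ} (hs : 1 ≤ s) (hsb : s ≤ b) (hbp : b ≤ p)
    (hpb : p ≤ b + 1) (hce : c + e = p + b) (hse : s ≤ e) (hcp : c ≠ p) (hX : (p : ℝ) * b < X)
    (hroot : X ^ 2 - ((p : ℝ) * b + s) * X + p * s * (b - s) = 0) :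
    0 < X ^ 2 - ((c : ℝ) * e + s) * X + c * s * (e - s) := by
  have he : (e : ℝ) = p + b - c := by
    have : (c : ℝ) + e = p + b := by exact_mod_cast hce
    linarith
  have hfac : X ^ 2 - ((c : ℝ) * e + s) * X + c * s * (e - s) =
      ((c : ℝ) - p) * ((c - b) * (X - s) - s ^ 2) := by
    rw [he]
    linear_combination hroot
  rw [hfac]
  have hs' : (1 : ℝ) ≤ s := by exact_mod_cast hs
  have hbp' : (b : ℝ) ≤ p := by exact_mod_cast hbp
  rcases lt_or_gt_of_ne hcp with h | h
  · have h1 : (c : ℝ) < p := by exact_mod_cast h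
    have h2 : (c : ℝ) ≤ b := by exact_mod_cast (by omega : c ≤ b)
    have h3 : (s : ℝ) ≤ X := by
      have : (s : ℝ) ≤ p * b := by exact_mod_cast (by nlinarith : s ≤ p * b)
      linarith
    refine mul_pos_of_neg_of_neg (by linarith) ?_
    nlinarith [mul_nonneg (sub_nonneg.2 h2) (sub_nonneg.2 h3)]
  · have h1 : (p : ℝ) + 1 ≤ c := by exact_mod_cast h
    have h2 : (s : ℝ) + 1 ≤ b := by exact_mod_cast (by omega : s + 1 ≤ b)
    have h3 : (s : ℝ) ^ 2 < X - s := by nlinarith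
    refine mul_pos (by linarith) ?_
    nlinarith

theorem mul_le_mul_of_balanced {p b c e : ℕ} (hbp : b ≤ p) (hpb : p ≤ b + 1)
    (hce : c + e = p + b) : c * e ≤ p * b := by
  zify at *
  have he : (e : ℤ) = p + b - c := by linarith
  rw [he]
  rcases le_or_gt (c : ℤ) b with h | h
  · nlinarith
  · have : (p : ℤ) ≤ c := by omega
    nlinarith

theorem exists_lt_quadratic_nonneg {X l B C : ℝ} (hl : l < X) (hX : 0 < X ^ 2 - B * X + C) :
    ∃ z, l < z ∧ z < X ∧ 0 ≤ z ^ 2 - B * z + C := by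
  have hc : ContinuousAt (fun z : ℝ => z ^ 2 - B * z + C) X := by fun_prop
  have h1 := (hc.eventually (lt_mem_nhds hX)).and (lt_mem_nhds hl)
  obtain ⟨z, ⟨h2, h3⟩, h4⟩ :=
    ((h1.filter_mono (nhdsWithin_le_nhds (s := Set.Iio X))).and self_mem_nhdsWithin).exists
  exact ⟨z, h3, h4, h2.le⟩

theorem estradaIndex_le_joinOneK1 {n s p b : ℕ} (hs : 1 ≤ s) (hsb : s ≤ b) (hbp : b ≤ p)
    (hpb : p ≤ b + 1) (hn : p + b + 1 = n) {G : SimpleGraph V} (hG : InClass n s G) :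
    estradaIndex G ≤ estradaIndex (joinOneK1 s p (b - s)) ∧
      (estradaIndex G = estradaIndex (joinOneK1 s p (b - s)) →
        Nonempty (G ≃g joinOneK1 s p (b - s))) := by
  classical
  obtain ⟨hcard, hbip, hκ⟩ := hG
  obtain ⟨q, rfl⟩ := Nat.exists_eq_add_of_le hsb
  rw [Nat.add_sub_cancel_left]
  have hbp' : ((s + q : ℕ) : ℝ) ≤ p := by exact_mod_cast hbp
  obtain ⟨X, y, hy, hyX, hpX, hXy, hX, hY⟩ := exists_sq_singular_values (p := p)
    (b := (s + q : ℕ)) (s := s) (by exact_mod_cast hs) (by exact_mod_cast hsb) hbp'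
  have hlow := le_estradaIndex_joinOneK1 (q := q) hs (by omega : 1 ≤ p) hy hyX
    (by push_cast at hX; rw [← hX]; ring) (by push_cast at hY; rw [← hY]; ring)
  have hcardH : Fintype.card (JoinOneVertex s 1 0 p q) = Fintype.card V := by
    simp
    omega
  rw [hcardH] at hlow
  -- It suffices to bound the Estrada index of `G` by the value on the left of `hlow`.
  suffices h : estradaIndex G <
      Fintype.card V + 2 * ((Real.cosh √X - 1) + (Real.cosh √y - 1)) ∨
      (estradaIndex G ≤ Fintype.card V + 2 * ((Real.cosh √X - 1) + (Real.cosh √y - 1)) ∧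
        Nonempty (G ≃g joinOneK1 s p q)) by
    rcases h with h | ⟨h, e⟩
    · exact ⟨(h.trans_le hlow).le, fun h' => absurd h' (h.trans_le hlow).ne⟩
    · exact ⟨h.trans hlow, fun _ => e⟩
  have hdeg : ∀ x, s ≤ G.degree x := fun x => hκ ▸ vertexConnectivity_le_degree G x
  have hs' : (1 : ℝ) ≤ s := by exact_mod_cast hs
  by_cases hgt : ∀ x, s < G.degree x
  · -- All degrees exceed `s`: the graph has at most `p * b` edges.
    left
    have h4 := four_mul_card_edgeFinset_le hbip (by rwa [hκ]) (by omega)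
    have hm : #G.edgeFinset ≤ p * (s + q) := by
      rw [hcard, ← hn] at h4
      obtain h | h : p = s + q ∨ p = s + q + 1 := by omega
      · rw [h] at h4 ⊢
        by_contra hlt
        push Not at hlt
        nlinarith
      · rw [h] at h4 ⊢
        nlinarith
    have hm' : (#G.edgeFinset : ℝ) ≤ p * (s + q : ℕ) := by exact_mod_cast hm
    exact estradaIndex_lt hbip hy hyX.le
      (fun i => (adjEigenvalues_sq_le_card_edgeFinset hbip i).trans (hm'.trans hpX.le))
      (by linarith)
  · push Not at hgt
    obtain ⟨v, hv⟩ := hgt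
    replace hv : G.degree v = s := le_antisymm hv (hdeg v)
    obtain ⟨A, hvA, hA⟩ := exists_isBipartition hbip v
    set c := #(A.erase v)
    set e := #Aᶜ
    have hce : c + e = p + (s + q) := by
      have h1 := Finset.card_erase_add_one hvA
      have h2 := Finset.card_add_card_compl A
      omega
    have hse : s ≤ e := by
      rw [← hv, ← SimpleGraph.card_neighborFinset_eq_degree]
      exact Finset.card_le_card (hA.neighborFinset_subset hvA)
    have hm : #G.edgeFinset ≤ s + c * e := hv ▸ card_edgeFinset_le_of_mem hA hvA
    have hcepb := mul_le_mul_of_balanced hbp hpb hce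
    have hmt : (#G.edgeFinset : ℝ) ≤ X + y := by
      rw [hXy]
      exact_mod_cast hm.trans (by omega)
    have hsX : (s : ℝ) < X := by
      have : (s : ℝ) ≤ p * (s + q : ℕ) := by exact_mod_cast (by nlinarith : s ≤ p * (s + q))
      linarith
    have hspec : ∀ z : ℝ, (s : ℝ) < z →
        0 ≤ z ^ 2 - ((c : ℝ) * e + s) * z + c * s * (e - s) →
        ∀ i, adjEigenvalues G i ^ 2 ≤ z := fun z hz hQ i =>
      adjEigenvalues_sq_le_of_mem hA hvA (by omega) (by rwa [hv]) (by rwa [hv]) i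
    by_cases hcp : c = p
    · have heb : e = s + q := by omega
      have hXbound := hspec X hsX (by rw [hcp, heb]; exact hX.ge)
      by_cases hmlt : #G.edgeFinset = s + c * e
      · refine Or.inr ⟨estradaIndex_le hbip hy hyX.le hXbound hmt, ?_⟩
        exact nonempty_iso_joinOneK1 hA hvA hv hcp heb fun x hx =>
          neighborFinset_eq_of_card_edgeFinset_eq hA hvA (by rw [hv]; exact hmlt) hx
      · refine Or.inl (estradaIndex_lt hbip hy hyX.le hXbound ?_)
        rw [hXy]
        exact_mod_cast (lt_of_le_of_ne hm hmlt).trans_le (by omega)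
    · -- The spectral radius is strictly smaller, and spreading `z, X + y - z` to `X, y` is a gain.
      left
      obtain ⟨z, hlz, hzX, hQ⟩ := exists_lt_quadratic_nonneg (l := max s ((X + y) / 2))
        (max_lt hsX (by linarith)) (quadratic_pos_of_ne hs hsb hbp hpb hce hse hcp hpX hX)
      have h1 := (le_max_left _ _).trans_lt hlz
      have h2 := (le_max_right _ _).trans_lt hlz
      have hle := estradaIndex_le hbip (X := z) (y := X + y - z) (by linarith) (by linarith)
        (hspec z h1 hQ) (by linarith)
      have hspread := cosh_sqrt_add_lt_of_spread (a := z) (b := X + y - z) (c := X)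
        (by linarith) (by linarith) hzX (by linarith) (by linarith)
      rw [show z + (X + y - z) - X = y by ring] at hspread
      linarith

end Maximality

theorem ceil_sub_one_div_two (n : ℕ) : ⌈((n : ℚ) - 1) / 2⌉₊ = n / 2 := by
  obtain ⟨k, rfl | rfl⟩ := Nat.even_or_odd' n
  · rcases k with _ | k
    · norm_num
    · rw [Nat.mul_div_cancel_left _ two_pos, Nat.ceil_eq_iff (by omega)]
      push_cast
      constructor <;> linarith
  · rw [show (2 * k + 1) / 2 = k by omega]
    have : (((2 * k + 1 : ℕ) : ℚ) - 1) / 2 = k := by push_cast; ring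
    rw [this, Nat.ceil_natCast]

theorem floor_sub_one_div_two (n : ℕ) : ⌊((n : ℚ) - 1) / 2⌋₊ = (n - 1) / 2 := by
  rcases n with _ | n
  · norm_num
  · have : (((n + 1 : ℕ) : ℚ) - 1) / 2 = (n : ℚ) / (2 : ℕ) := by push_cast; ring
    rw [this, Nat.floor_div_natCast, Nat.floor_natCast, Nat.add_sub_cancel]

end EstradaBip

theorem theorem4p5 (n s : ℕ) (hs : 1 ≤ s) :
    (2 * s < n →
      EstradaBip.IsUniqueMaximizer.{u} n s
        (EstradaBip.joinOneK1 s ⌈((n : ℚ) - 1) / 2⌉₊ (⌊((n : ℚ) - 1) / 2⌋₊ - s))) ∧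
    (n = 2 * s →
      EstradaBip.IsUniqueMaximizer.{u} n s
        (completeBipartiteGraph (Fin s) (Fin s))) := by
  constructor
  · intro hn
    rw [EstradaBip.ceil_sub_one_div_two, EstradaBip.floor_sub_one_div_two]
    refine ⟨EstradaBip.inClass_joinOneK1 hs (by omega) (by omega), fun V _ G hG => ?_⟩
    exact EstradaBip.estradaIndex_le_joinOneK1 hs (by omega) (by omega) (by omega) (by omega) hG
  · rintro rfl
    refine ⟨EstradaBip.inClass_completeBipartiteGraph hs, fun V _ G hG => ?_⟩
    obtain ⟨e⟩ := EstradaBip.nonempty_iso_completeBipartiteGraph hs hG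
    exact ⟨(EstradaBip.estradaIndex_eq_of_iso e).le, fun _ => ⟨e⟩⟩
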